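/- All linear orders are (non-strict) linear orders $\leq_L$ with field $\omega$, identified with the sets $\{\langle x,y\rangle : x\leq_L y\}\subseteq\omega$ for a standard computable pairing bijection. Call $x$ *small* (*large*) in $\leq_L$ if $\{y : y<_L x\}$ (respectively $\{y : x<_L y\}$) is finite; $\leq_L$ is *stable* if every $x$ is small or large (equivalently, $\leq_L$ has type $k+\omega^*$, $\omega+\omega^*$ or $\omega+k$ for some $k\in\omega$). A set $S\subseteq\omega$ is an *ascending* (*descending*) *sequence* for $\leq_L$ if for all $x\leq y$ in $S$ we have $x\leq_L y$ (respectively $y\leq_L x$); it is an *ascending* (*descending*) *chain* if for every $x\in S$ there are only finitely many $y\in S$ with $y\leq_L x$ (respectively $x\leq_L y$). Consider the following problems. The instances of $\mathsf{General}\text{-}\mathsf{SADS}$ and of $\mathsf{General}\text{-}\mathsf{SADC}$ are all stable linear orders; the instances of $\mathsf{SADS}$ and of $\mathsf{SADC}$ are the stable linear orders with infinitely many small and infinitely many large elements (type $\omega+\omega^*$). The solutions to an instance $\leq_L$ of $\mathsf{SADS}$ or $\mathsf{General}\text{-}\mathsf{SADS}$ are the infinite ascending sequences and infinite descending sequences for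 $\leq_L$; the solutions to an instance $\leq_L$ of $\mathsf{SADC}$ or $\mathsf{General}\text{-}\mathsf{SADC}$ are the infinite ascending chains and infinite descending chains for $\leq_L$. For problems $\mathsf{P},\mathsf{Q}$, write $\mathsf{P}\leq_{\mathrm W}\mathsf{Q}$ ($\mathsf{P}$ is Weihrauch reducible to $\mathsf{Q}$) if there are Turing functionals $\Phi,\Delta$ such that for every instance $X$ of $\mathsf{P}$, $\Phi^X$ is an instance of $\mathsf{Q}$, and for every solution $\widehat Y$ to $\Phi^X$, $\Delta^{X\oplus\widehat Y}$ is a solution to $X$. Write $\mathsf{P}<_{\mathrm W}\mathsf{Q}$ if $\mathsf{P}\leq_{\mathrm W}\mathsf{Q}$ and $\mathsf{Q}\nleq_{\mathrm W}\mathsf{P}$. **Theorem.** $\mathsf{General}\text{-}\mathsf{SADC}\nleq_{\mathrm W}\mathsf{SADS}$. Moreover, $\mathsf{SADS}<_{\mathrm W}\mathsf{General}\text{-}\mathsf{SADS}$ and $\mathsf{SADC}<_{\mathrm W}\mathsf{General}\text{-}\mathsf{SADC}$. -/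

import Mathlib

/-- Programs for Turing functionals: partial recursive programs with a basic instruction that
queries the oracle. -/
inductive TuringFunctional : Type
  | zero : TuringFunctional
  | succ : TuringFunctional
  | left : TuringFunctional
  | right : TuringFunctional
  | oracle : TuringFunctional
  | pair : TuringFunctional → TuringFunctional → TuringFunctional
  | comp : TuringFunctional → TuringFunctional → TuringFunctional
  | prec : TuringFunctional → TuringFunctional → TuringFunctional
  | rfind : TuringFunctional → TuringFunctional

namespace TuringFunctional

open Classical in
/-- The characteristic function of a set of natural numbers. -/
noncomputable def charFun (A : Set ℕ) (n : ℕ) : ℕ := if n ∈ A then 1 else 0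

/-- `eval Φ A` is the partial function computed by the functional `Φ` with the set `A` as oracle.
The clauses are those of `Nat.RecursiveIn`. -/
noncomputable def eval : TuringFunctional → Set ℕ → ℕ →. ℕ
  | zero, _ => fun _ => Part.some 0
  | succ, _ => fun n => Part.some (n + 1)
  | left, _ => fun n => Part.some n.unpair.1
  | right, _ => fun n => Part.some n.unpair.2
  | oracle, A => fun n => Part.some (charFun A n)
  | pair f g, A => fun n => Nat.pair <$> eval f A n <*> eval g A n
  | comp f g, A => fun n => eval g A n >>= eval f A
  | prec f g, A => fun p =>
      Nat.rec (eval f A p.unpair.1)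
        (fun y IH => do
          let i ← IH
          eval g A (Nat.pair p.unpair.1 (Nat.pair y i)))
        p.unpair.2
  | rfind f, A => fun a =>
      Nat.rfind fun n => (fun m => decide (m = 0)) <$> eval f A (Nat.pair a n)

/-- `Φ.Computes A B` means `Φ^A = B`: with oracle `A`, the functional `Φ` converges on every input
and its value at `n` is `1` if `n ∈ B` and `0` otherwise. -/
def Computes (Φ : TuringFunctional) (A B : Set ℕ) : Prop :=
  ∀ n, eval Φ A n = Part.some (charFun B n)

end TuringFunctional

/-- The join `X ⊕ Y` of two sets of natural numbers: evens code `X`, odds code `Y`. -/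
def joinSet (X Y : Set ℕ) : Set ℕ :=
  {n | (∃ x ∈ X, n = 2 * x) ∨ ∃ y ∈ Y, n = 2 * y + 1}

/-- A problem: a class of instances, and for each instance a class of solutions. -/
structure Problem where
  /-- `IsInstance X`: the set `X` is an instance. -/
  IsInstance : Set ℕ → Prop
  /-- `IsSolution X Y`: the set `Y` is a solution to the instance `X`. -/
  IsSolution : Set ℕ → Set ℕ → Prop

/-- Weihrauch reducibility. -/
def Problem.WeihrauchLE (P Q : Problem) : Prop :=
  ∃ Φ Δ : TuringFunctional, ∀ X, P.IsInstance X →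
    ∃ X', Φ.Computes X X' ∧ Q.IsInstance X' ∧
      ∀ Y', Q.IsSolution X' Y' →
        ∃ Y, Δ.Computes (joinSet X Y') Y ∧ P.IsSolution X Y

/-- Strict Weihrauch reducibility. -/
def Problem.WeihrauchLT (P Q : Problem) : Prop :=
  P.WeihrauchLE Q ∧ ¬ Q.WeihrauchLE P

/-- The binary relation on `ℕ` coded by a set of natural numbers via the pairing function. -/
def codedLE (L : Set ℕ) (x y : ℕ) : Prop := Nat.pair x y ∈ L

/-- The strict part of the coded relation. -/
def codedLT (L : Set ℕ) (x y : ℕ) : Prop := codedLE L x y ∧ x ≠ y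

/-- `L` codes a (non-strict) linear order with field `ℕ`. -/
def CodesLinearOrder (L : Set ℕ) : Prop :=
  (∀ x, codedLE L x x) ∧
  (∀ x y, codedLE L x y → codedLE L y x → x = y) ∧
  (∀ x y z, codedLE L x y → codedLE L y z → codedLE L x z) ∧
  (∀ x y, codedLE L x y ∨ codedLE L y x)

/-- Only finitely many elements lie strictly below `x`. -/
def IsSmall (L : Set ℕ) (x : ℕ) : Prop := {y | codedLT L y x}.Finite

/-- Only finitely many elements lie strictly above `x`. -/
def IsLarge (L : Set ℕ) (x : ℕ) : Prop := {y | codedLT L x y}.Finite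

/-- `L` codes a stable linear order: every element is small or large. -/
def IsStableOrder (L : Set ℕ) : Prop :=
  CodesLinearOrder L ∧ ∀ x, IsSmall L x ∨ IsLarge L x

/-- `L` codes a stable linear order with infinitely many small and infinitely many large elements,
that is, one of type `ω + ω*`. -/
def IsStableOrderOmegaOmegaStar (L : Set ℕ) : Prop :=
  IsStableOrder L ∧ {x | IsSmall L x}.Infinite ∧ {x | IsLarge L x}.Infinite

def IsAscendingSequence (L S : Set ℕ) : Prop :=
  ∀ x ∈ S, ∀ y ∈ S, x ≤ y → codedLE L x y

def IsDescendingSequence (L S : Set ℕ) : Prop :=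
  ∀ x ∈ S, ∀ y ∈ S, x ≤ y → codedLE L y x

def IsAscendingChain (L S : Set ℕ) : Prop :=
  ∀ x ∈ S, {y | y ∈ S ∧ codedLE L y x}.Finite

def IsDescendingChain (L S : Set ℕ) : Prop :=
  ∀ x ∈ S, {y | y ∈ S ∧ codedLE L x y}.Finite

/-- Orders of type `ω + ω*`; infinite ascending or descending sequences. -/
def SADS : Problem where
  IsInstance := IsStableOrderOmegaOmegaStar
  IsSolution L S := S.Infinite ∧ (IsAscendingSequence L S ∨ IsDescendingSequence L S)

/-- Orders of type `ω + ω*`; infinite ascending or descending chains. -/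
def SADC : Problem where
  IsInstance := IsStableOrderOmegaOmegaStar
  IsSolution L S := S.Infinite ∧ (IsAscendingChain L S ∨ IsDescendingChain L S)

/-- All stable linear orders; infinite ascending or descending sequences. -/
def GeneralSADS : Problem where
  IsInstance := IsStableOrder
  IsSolution L S := S.Infinite ∧ (IsAscendingSequence L S ∨ IsDescendingSequence L S)

/-- All stable linear orders; infinite ascending or descending chains. -/
def GeneralSADC : Problem where
  IsInstance := IsStableOrder
  IsSolution L S := S.Infinite ∧ (IsAscendingChain L S ∨ IsDescendingChain L S)

/-!
Each special problem has fewer instances than its general version and the same solutions, so the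
two reductions are witnessed by the identity. Infinite sequences are chains, so both failures of the
converse reductions follow from the first non-reduction. That one is an argument about continuity
and Baire category.

For every set `A` there is a stable order `cutOrder A` in which the small elements are those outside
`A` and the large ones are those in `A`; infinite ascending chains avoid `A` and infinite descending
chains lie inside `A`. Given functionals `Φ` and `Δ` witnessing a reduction of `GeneralSADC` to
`SADS`, let `M A` be the order of type `ω + ω*` which `Φ` computes from `cutOrder A`. A functional
that converges has only used finitely much of its oracle (`TuringFunctional.exists_use`), so `M A`
depends continuously on `A`. By the Baire category theorem there is an `A` which decides, for all
`s` and `m`, whether some `n > m` lies below `s` in the order `M A` (`exists_deciding`): either this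
happens, or a finite part of `A` prevents it for every `B` sharing that finite part. Hence for each
`s` small in `M A`, a finite part of `A` guarantees that `s` is small in `M B`.

Take an infinite ascending sequence `S` for `M A`. From it, `Δ` computes an infinite chain, and a
finite part `F` of `S` and a finite part of `A` suffice to put some `w` into that chain. Enlarge the
finite part of `A` so that the last element of `F` remains small, and change `A` beyond it to a `B`
for which no infinite chain contains `w`: a cofinite set if `w ∉ A`, a finite one if `w ∈ A`. As the
last element of `F` is small in `M B`, the finite sequence `F` extends to an infinite ascending
sequence for `M B`, and from this `Δ` computes a chain containing `w`, a contradiction.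
-/

/-! ### The use principle -/

/-- `A` and `B` have the same elements below `k`. -/
def AgreeBelow (k : ℕ) (A B : Set ℕ) : Prop := ∀ i < k, i ∈ A ↔ i ∈ B

theorem AgreeBelow.mono {k l : ℕ} {A B : Set ℕ} (h : AgreeBelow l A B) (hkl : k ≤ l) :
    AgreeBelow k A B :=
  fun i hi => h i (hi.trans_le hkl)

namespace TuringFunctional

theorem charFun_eq_charFun_iff {A B : Set ℕ} {m n : ℕ} :
    charFun A m = charFun B n ↔ (m ∈ A ↔ n ∈ B) := by
  by_cases hA : m ∈ A <;> by_cases hB : n ∈ B <;> simp [charFun, hA, hB]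

/-- The use principle: a converging computation looks only at a finite part of its oracle. -/
theorem exists_use (Φ : TuringFunctional) (A : Set ℕ) :
    ∀ n v, v ∈ eval Φ A n → ∃ k, ∀ B, AgreeBelow k A B → v ∈ eval Φ B n := by
  induction Φ with
  | zero => exact fun n v h => ⟨0, fun B _ => h⟩
  | succ => exact fun n v h => ⟨0, fun B _ => h⟩
  | left => exact fun n v h => ⟨0, fun B _ => h⟩
  | right => exact fun n v h => ⟨0, fun B _ => h⟩
  | oracle =>
    intro n v h
    refine ⟨n + 1, fun B hB => ?_⟩
    have : charFun A n = charFun B n := charFun_eq_charFun_iff.2 (hB n n.lt_succ_self)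
    simpa only [eval, this] using h
  | pair f g hf hg =>
    intro n v h
    simp only [eval, Seq.seq, Part.map_eq_map, Part.mem_bind_iff, Part.mem_map_iff,
      exists_exists_and_eq_and] at h ⊢
    obtain ⟨a, ha, b, hb, rfl⟩ := h
    obtain ⟨k, hk⟩ := hf n a ha
    obtain ⟨l, hl⟩ := hg n b hb
    exact ⟨max k l, fun B hB => ⟨a, hk B (hB.mono (le_max_left _ _)), b,
      hl B (hB.mono (le_max_right _ _)), rfl⟩⟩
  | comp f g hf hg =>
    intro n v h
    obtain ⟨a, ha, hv⟩ := Part.mem_bind_iff.1 h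
    obtain ⟨k, hk⟩ := hg n a ha
    obtain ⟨l, hl⟩ := hf a v hv
    exact ⟨max k l, fun B hB => Part.mem_bind_iff.2 ⟨a, hk B (hB.mono (le_max_left _ _)),
      hl B (hB.mono (le_max_right _ _))⟩⟩
  | prec f g hf hg =>
    intro p v h
    simp only [eval] at h ⊢
    generalize p.unpair.2 = y at h ⊢
    induction y generalizing v with
    | zero => exact hf _ v h
    | succ y ih =>
      simp only [Part.bind_eq_bind, Part.mem_bind_iff] at h ⊢
      obtain ⟨a, ha, hv⟩ := h
      obtain ⟨k, hk⟩ := ih a ha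
      obtain ⟨l, hl⟩ := hg _ v hv
      exact ⟨max k l, fun B hB => ⟨a, hk B (hB.mono (le_max_left _ _)),
        hl B (hB.mono (le_max_right _ _))⟩⟩
  | rfind f hf =>
    intro n v h
    obtain ⟨htrue, hlt⟩ := Nat.mem_rfind.1 h
    obtain ⟨a, ha, ha0⟩ := (Part.mem_map_iff _).1 htrue
    obtain ⟨k, hk⟩ := hf _ a ha
    have hlt' : ∀ m, ∃ l, m < v → ∀ B, AgreeBelow l A B →
        false ∈ (eval f B (Nat.pair n m)).map fun b => decide (b = 0) := by
      intro m
      by_cases hm : m < v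
      · obtain ⟨b, hb, hb0⟩ := (Part.mem_map_iff _).1 (hlt hm)
        obtain ⟨l, hl⟩ := hf _ b hb
        exact ⟨l, fun _ B hB => (Part.mem_map_iff _).2 ⟨b, hl B hB, hb0⟩⟩
      · exact ⟨0, fun h => absurd h hm⟩
    choose l hl using hlt'
    refine ⟨max k ((Finset.range v).sup l), fun B hB => Nat.mem_rfind.2
      ⟨(Part.mem_map_iff _).2 ⟨a, hk B (hB.mono (le_max_left _ _)), ha0⟩, fun {m} hm => hl m hm B (hB.mono ?_)⟩⟩
    exact (Finset.le_sup (f := l) (Finset.mem_range.2 hm)).trans (le_max_right _ _)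

/-- The use principle for a functional computing sets. -/
theorem Computes.exists_use {Φ : TuringFunctional} {A C : Set ℕ} (h : Φ.Computes A C) (n : ℕ) :
    ∃ k, ∀ B D, AgreeBelow k A B → Φ.Computes B D → (n ∈ C ↔ n ∈ D) := by
  obtain ⟨k, hk⟩ := Φ.exists_use A n (charFun C n) (by rw [h n]; exact Part.mem_some _)
  refine ⟨k, fun B D hB hD => ?_⟩
  have := hk B hB
  rw [hD n, Part.mem_some_iff] at this
  exact charFun_eq_charFun_iff.1 this

/-- A program computing `Y` from `X ⊕ Y`: it queries the oracle at `2 * n + 1`, which is computed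
by recursion from `1` by adding `2`. -/
def snd : TuringFunctional :=
  comp oracle (comp (prec (comp succ zero) (comp succ (comp succ (comp right right))))
    (pair zero (pair left right)))

theorem snd_computes (X Y : Set ℕ) : snd.Computes (joinSet X Y) Y := by
  have hrec : ∀ n : ℕ, (Nat.rec (Part.some 1)
      (fun y IH => IH.bind fun i => Part.some (i + 1 + 1)) n : Part ℕ) = Part.some (2 * n + 1) := by
    intro n
    induction n with
    | zero => rfl
    | succ n ih =>
      simp only [ih, Part.bind_some]
      congr 1
  have hmem : ∀ n, 2 * n + 1 ∈ joinSet X Y ↔ n ∈ Y := by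
    intro n
    constructor
    · rintro (⟨x, -, h⟩ | ⟨y, hy, h⟩)
      · omega
      · obtain rfl : n = y := by omega
        exact hy
    · exact fun h => Or.inr ⟨n, h, rfl⟩
  intro n
  simp [snd, eval, Seq.seq, hrec, charFun_eq_charFun_iff, hmem]

end TuringFunctional

open TuringFunctional

theorem AgreeBelow.joinSet {k : ℕ} {X X' Y Y' : Set ℕ} (hX : AgreeBelow k X X')
    (hY : AgreeBelow k Y Y') : AgreeBelow k (joinSet X Y) (joinSet X' Y') := by
  intro i hi
  constructor
  · rintro (⟨x, hx, rfl⟩ | ⟨y, hy, rfl⟩)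
    · exact Or.inl ⟨x, (hX x (by omega)).1 hx, rfl⟩
    · exact Or.inr ⟨y, (hY y (by omega)).1 hy, rfl⟩
  · rintro (⟨x, hx, rfl⟩ | ⟨y, hy, rfl⟩)
    · exact Or.inl ⟨x, (hX x (by omega)).2 hx, rfl⟩
    · exact Or.inr ⟨y, (hY y (by omega)).2 hy, rfl⟩

/-! ### Reductions between problems with more or fewer instances and solutions -/

theorem Problem.weihrauchLE_of_imp {P Q : Problem} (hI : ∀ X, P.IsInstance X → Q.IsInstance X)
    (hS : ∀ X Y, Q.IsSolution X Y → P.IsSolution X Y) : P.WeihrauchLE Q :=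
  ⟨oracle, snd, fun X hX => ⟨X, fun _ => rfl, hI X hX, fun Y hY =>
    ⟨Y, snd_computes X Y, hS X Y hY⟩⟩⟩

theorem Problem.WeihrauchLE.mono {P P' Q Q' : Problem} (h : P.WeihrauchLE Q)
    (hP : ∀ X, P'.IsInstance X → P.IsInstance X)
    (hPS : ∀ X Y, P'.IsInstance X → P.IsSolution X Y → P'.IsSolution X Y)
    (hQ : ∀ X, Q.IsInstance X → Q'.IsInstance X)
    (hQS : ∀ X Y, Q.IsInstance X → Q'.IsSolution X Y → Q.IsSolution X Y) : P'.WeihrauchLE Q' := by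
  obtain ⟨Φ, Δ, h⟩ := h
  refine ⟨Φ, Δ, fun X hX => ?_⟩
  obtain ⟨X', hc, hi, hs⟩ := h X (hP X hX)
  refine ⟨X', hc, hQ X' hi, fun Y' hY' => ?_⟩
  obtain ⟨Y, hY, hsol⟩ := hs Y' (hQS X' Y' hi hY')
  exact ⟨Y, hY, hPS X Y hX hsol⟩

theorem CodesLinearOrder.isAscendingChain {L S : Set ℕ} (hL : CodesLinearOrder L)
    (h : IsAscendingSequence L S) : IsAscendingChain L S := by
  intro x hx
  refine (Set.finite_Iic x).subset fun y ⟨hy, hyx⟩ => ?_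
  by_contra hlt
  have hxy : x < y := not_le.1 hlt
  exact hxy.ne (hL.2.1 x y (h x hx y hy hxy.le) hyx)

theorem CodesLinearOrder.isDescendingChain {L S : Set ℕ} (hL : CodesLinearOrder L)
    (h : IsDescendingSequence L S) : IsDescendingChain L S := by
  intro x hx
  refine (Set.finite_Iic x).subset fun y ⟨hy, hxy⟩ => ?_
  by_contra hlt
  have hlt' : x < y := not_le.1 hlt
  exact hlt'.ne (hL.2.1 x y hxy (h x hx y hy hlt'.le))

theorem CodesLinearOrder.chain_of_sequence {L S : Set ℕ} (hL : CodesLinearOrder L)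
    (h : S.Infinite ∧ (IsAscendingSequence L S ∨ IsDescendingSequence L S)) :
    S.Infinite ∧ (IsAscendingChain L S ∨ IsDescendingChain L S) :=
  ⟨h.1, h.2.imp hL.isAscendingChain hL.isDescendingChain⟩

/-! ### Ascending sequences in orders of type `ω + ω*` -/

/-- The small elements all of whose predecessors are numerically smaller. In an order with
infinitely many small elements these form an infinite ascending sequence. -/
def smallRecords (M : Set ℕ) : Set ℕ := {y | IsSmall M y ∧ ∀ z, codedLT M z y → z < y}

theorem CodesLinearOrder.isAscendingSequence_smallRecords {M : Set ℕ} (hM : CodesLinearOrder M) :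
    IsAscendingSequence M (smallRecords M) := by
  intro x hx y _ hxy
  rcases hM.2.2.2 x y with h | h
  · exact h
  · by_contra hn
    have hne : y ≠ x := fun e => hn (e ▸ hM.1 x)
    exact absurd (hx.2 y ⟨h, hne⟩) (not_lt.2 hxy)

theorem CodesLinearOrder.codedLT_trans {M : Set ℕ} (hM : CodesLinearOrder M) {x y z : ℕ}
    (hxy : codedLT M x y) (hyz : codedLT M y z) : codedLT M x z :=
  ⟨hM.2.2.1 x y z hxy.1 hyz.1, fun e => hyz.2 (hM.2.1 y z hyz.1 (e ▸ hxy.1))⟩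

theorem CodesLinearOrder.infinite_smallRecords {M : Set ℕ} (hM : CodesLinearOrder M)
    (hinf : {x | IsSmall M x}.Infinite) : (smallRecords M).Infinite := by
  refine Set.infinite_of_not_bddAbove fun ⟨N, hN⟩ => ?_
  -- the least element, in the order coded by `M`, among the small `y > N`, is a record
  have hne : {y | IsSmall M y ∧ N < y}.Nonempty := by
    obtain ⟨y, hy, hNy⟩ := hinf.exists_gt N
    exact ⟨y, hy, hNy⟩
  obtain ⟨y, ⟨hy, hNy⟩, hmin⟩ :=
    exists_minimalFor_of_wellFoundedLT (fun y => y ∈ {y | IsSmall M y ∧ N < y})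
      (fun y => {z | codedLT M z y}.ncard) hne
  refine absurd (hN (a := y) ⟨hy, fun z hz => ?_⟩) (not_le.2 hNy)
  by_contra hyz
  have hsub : {u | codedLT M u z} ⊂ {u | codedLT M u y} :=
    Set.ssubset_iff_of_subset (fun u hu => hM.codedLT_trans hu hz) |>.2
      ⟨z, hz, fun h => h.2 rfl⟩
  have hlt := Set.ncard_lt_ncard hsub hy
  exact absurd (hmin (j := z) ⟨hy.subset hsub.subset, hNy.trans_le (not_lt.1 hyz)⟩ hlt.le)
    (not_le.2 hlt)

/-- A finite ascending sequence, presented as the part of `S` up to `s`, whose last element `s` is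
small extends to an infinite ascending sequence without adding elements up to `s`. -/
theorem CodesLinearOrder.exists_extend_ascending {M S : Set ℕ} {s : ℕ} (hM : CodesLinearOrder M)
    (hinf : {x | IsSmall M x}.Infinite) (hs : s ∈ S) (hsmall : IsSmall M s)
    (hS : IsAscendingSequence M (S ∩ Set.Iic s)) :
    ∃ T : Set ℕ, T.Infinite ∧ IsAscendingSequence M T ∧ AgreeBelow (s + 1) S T := by
  have hle : ∀ x ∈ S ∩ Set.Iic s, codedLE M x s := fun x hx => hS x hx s ⟨hs, Set.mem_Iic.2 le_rfl⟩ hx.2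
  refine ⟨S ∩ Set.Iic s ∪ {y | y ∈ smallRecords M ∧ s < y ∧ codedLE M s y}, ?_, ?_, ?_⟩
  · refine Set.Infinite.mono ?_
      (((hM.infinite_smallRecords hinf).sdiff (Set.finite_Iic s)).sdiff hsmall)
    rintro y ⟨⟨hy, hsy⟩, hys⟩
    have hlt : s < y := not_le.1 hsy
    exact Or.inr ⟨hy, hlt, (hM.2.2.2 s y).resolve_right fun h => hys ⟨h, hlt.ne'⟩⟩
  · rintro x (hx | ⟨hx, hsx, hsx'⟩) y (hy | ⟨hy, hsy, hsy'⟩) hxy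
    · exact hS x hx y hy hxy
    · exact hM.2.2.1 x s y (hle x hx) hsy'
    · exact absurd (hsx.trans_le hxy) (not_lt.2 hy.2)
    · exact hM.isAscendingSequence_smallRecords x hx y hy hxy
  · intro i hi
    refine ⟨fun h => Or.inl ⟨h, Nat.lt_succ_iff.1 hi⟩, ?_⟩
    rintro (h | h)
    · exact h.1
    · exact absurd h.2.1 (by omega)

/-! ### The stable order with prescribed large elements -/

/-- The order in which the elements outside `A` come first, in their natural order, followed by
the elements of `A` in reverse order. -/
def cutOrder (A : Set ℕ) : Set ℕ :=
  {n | (n.unpair.1 ∉ A ∧ n.unpair.2 ∉ A ∧ n.unpair.1 ≤ n.unpair.2) ∨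
    (n.unpair.1 ∉ A ∧ n.unpair.2 ∈ A) ∨
    (n.unpair.1 ∈ A ∧ n.unpair.2 ∈ A ∧ n.unpair.2 ≤ n.unpair.1)}

theorem codedLE_cutOrder {A : Set ℕ} {x y : ℕ} : codedLE (cutOrder A) x y ↔
    (x ∉ A ∧ y ∉ A ∧ x ≤ y) ∨ (x ∉ A ∧ y ∈ A) ∨ (x ∈ A ∧ y ∈ A ∧ y ≤ x) := by
  simp [codedLE, cutOrder]

theorem AgreeBelow.cutOrder {k : ℕ} {A B : Set ℕ} (h : AgreeBelow k A B) :
    AgreeBelow k (cutOrder A) (cutOrder B) := by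
  intro i hi
  have h1 := h _ ((Nat.unpair_left_le i).trans_lt hi)
  have h2 := h _ ((Nat.unpair_right_le i).trans_lt hi)
  simp only [_root_.cutOrder, Set.mem_ofPred_eq, h1, h2]

theorem isSmall_cutOrder {A : Set ℕ} {x : ℕ} (hx : x ∉ A) : IsSmall (cutOrder A) x := by
  refine (Set.finite_Iic x).subset fun y hy => ?_
  have := codedLE_cutOrder.1 hy.1
  simp only [hx, Set.mem_Iic] at this ⊢
  tauto

theorem isLarge_cutOrder {A : Set ℕ} {x : ℕ} (hx : x ∈ A) : IsLarge (cutOrder A) x := by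
  refine (Set.finite_Iic x).subset fun y hy => ?_
  have := codedLE_cutOrder.1 hy.1
  simp only [hx, Set.mem_Iic] at this ⊢
  tauto

theorem isStableOrder_cutOrder (A : Set ℕ) : IsStableOrder (cutOrder A) := by
  refine ⟨⟨fun x => ?_, fun x y => ?_, fun x y z => ?_, fun x y => ?_⟩, fun x => ?_⟩
  · rw [codedLE_cutOrder]
    have := le_refl x
    tauto
  · simp only [codedLE_cutOrder]
    have := le_antisymm (a := x) (b := y)
    tauto
  · simp only [codedLE_cutOrder]
    have := le_trans (a := x) (b := y) (c := z)
    have := le_trans (a := z) (b := y) (c := x)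
    tauto
  · simp only [codedLE_cutOrder]
    have := le_total x y
    tauto
  · exact (em (x ∈ A)).symm.imp isSmall_cutOrder isLarge_cutOrder

/-- In any linear order, if `x` is large, then an infinite ascending chain through `x` would be
finite both below and above `x`. -/
theorem IsAscendingChain.not_isLarge {L S : Set ℕ} (hL : CodesLinearOrder L)
    (h : IsAscendingChain L S) (hS : S.Infinite) {x : ℕ} (hx : x ∈ S) : ¬ IsLarge L x := by
  intro hlarge
  refine hS (((h x hx).union hlarge).subset fun y hy => ?_)
  by_cases hyx : codedLE L y x
  · exact Or.inl ⟨hy, hyx⟩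
  · exact Or.inr ⟨(hL.2.2.2 x y).resolve_right hyx, fun e => hyx (e ▸ hL.1 x)⟩

theorem IsDescendingChain.not_isSmall {L S : Set ℕ} (hL : CodesLinearOrder L)
    (h : IsDescendingChain L S) (hS : S.Infinite) {x : ℕ} (hx : x ∈ S) : ¬ IsSmall L x := by
  intro hsmall
  refine hS (((h x hx).union hsmall).subset fun y hy => ?_)
  by_cases hxy : codedLE L x y
  · exact Or.inl ⟨hy, hxy⟩
  · exact Or.inr ⟨(hL.2.2.2 x y).resolve_left hxy, fun e => hxy (e ▸ hL.1 x)⟩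

/-- An infinite chain for `cutOrder A` avoids `A` or lies inside `A`. -/
theorem cutOrder_chain {A S : Set ℕ} (hS : GeneralSADC.IsSolution (cutOrder A) S) :
    S ⊆ Aᶜ ∨ S ⊆ A :=
  hS.2.imp
    (fun h _ hx hA =>
      h.not_isLarge (isStableOrder_cutOrder A).1 hS.1 hx (isLarge_cutOrder hA))
    (fun h _ hx => by_contra fun hA =>
      h.not_isSmall (isStableOrder_cutOrder A).1 hS.1 hx (isSmall_cutOrder hA))

/-- Beyond any finite part containing the decision about `w`, a set can be continued so that no
infinite chain for the resulting stable order contains `w`. -/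
theorem exists_no_chain_through (A : Set ℕ) (k w : ℕ) (hw : w < k) :
    ∃ B, AgreeBelow k A B ∧ ∀ S, GeneralSADC.IsSolution (cutOrder B) S → w ∉ S := by
  by_cases hA : w ∈ A
  · -- a finite set: infinite chains avoid it
    refine ⟨A ∩ Set.Iio k, fun i hi => by simp [hi], fun S hS hwS => ?_⟩
    rcases cutOrder_chain hS with h | h
    · exact h hwS ⟨hA, hw⟩
    · exact hS.1 ((Set.finite_Iio k).subset (h.trans Set.inter_subset_right))
  · -- a cofinite set: infinite chains lie inside it
    refine ⟨A ∪ Set.Ici k, fun i hi => by simp [hi], fun S hS hwS => ?_⟩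
    rcases cutOrder_chain hS with h | h
    · exact hS.1 ((Set.finite_Iio k).subset fun x hx => Set.mem_Iio.2 <| not_le.1 fun hkx => h hx (Or.inr hkx))
    · exact (h hwS).elim hA (not_le.2 hw)

/-! ### Genericity -/

/-- Baire category on Cantor space: if `M` depends continuously on a set, then some `A` decides all
statements "there is an `n > m` such that `n` is below `s` in `M A`", in the sense that if the
statement fails, then it fails for all `B` sharing some finite part of `A`. -/
theorem exists_deciding (M : Set ℕ → Set ℕ)
    (hM : ∀ A n, ∃ k, ∀ B, AgreeBelow k A B → (n ∈ M A ↔ n ∈ M B)) :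
    ∃ A, ∀ s m, (∃ n > m, codedLT (M A) n s) ∨
      ∃ k, ∀ B, AgreeBelow k A B → ∀ n > m, ¬ codedLT (M B) n s := by
  let toSet : (ℕ → Bool) → Set ℕ := fun f => {i | f i = true}
  have hagree : ∀ {k f g}, g ∈ PiNat.cylinder f k → AgreeBelow k (toSet f) (toSet g) := by
    intro k f g hg i hi
    simp [toSet, PiNat.mem_cylinder_iff.1 hg i hi]
  let U : ℕ × ℕ → Set (ℕ → Bool) := fun p => {f | ∃ n > p.2, codedLT (M (toSet f)) n p.1}
  have hU : ∀ p, IsOpen (U p) := by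
    intro p
    refine isOpen_iff_mem_nhds.2 fun f ⟨n, hn, hlt⟩ => ?_
    obtain ⟨k, hk⟩ := hM (toSet f) (Nat.pair n p.1)
    refine Filter.mem_of_superset
      ((PiNat.isOpen_cylinder _ f k).mem_nhds (PiNat.self_mem_cylinder f k)) fun g hg => ?_
    exact ⟨n, hn, (hk _ (hagree hg)).1 hlt.1, hlt.2⟩
  have hdense : Dense (⋂ p, (U p ∪ interior (U p)ᶜ)) := by
    refine dense_iInter_of_isOpen (fun p => (hU p).union isOpen_interior) fun p => ?_
    rw [interior_compl]
    exact dense_iff_closure_eq.2 (Set.eq_univ_of_forall fun f => by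
      by_cases hf : f ∈ closure (U p)
      · exact closure_mono Set.subset_union_left hf
      · exact subset_closure (Or.inr hf))
  obtain ⟨f, hf⟩ := hdense.nonempty
  refine ⟨toSet f, fun s m => ?_⟩
  refine (Set.mem_iInter.1 hf (s, m)).imp id fun h => ?_
  obtain ⟨_, ⟨g, k, rfl⟩, hfg, hsub⟩ :=
    (PiNat.isTopologicalBasis_cylinders _).exists_subset_of_mem_open h isOpen_interior
  refine ⟨k, fun B hB n hn hlt => ?_⟩
  classical
  have hBset : toSet (fun i => decide (i ∈ B)) = B := by simp [toSet]
  have hmem : (fun i => decide (i ∈ B)) ∈ PiNat.cylinder g k := by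
    intro i hi
    rw [← PiNat.mem_cylinder_iff.1 hfg i hi, Bool.eq_iff_iff]
    simpa [toSet] using (hB i hi).symm
  exact interior_subset (hsub hmem) ⟨n, hn, by rwa [hBset]⟩

/-! ### The separation -/

theorem generalSADC_not_weihrauchLE_SADS : ¬ GeneralSADC.WeihrauchLE SADS := by
  rintro ⟨Φ, Δ, h⟩
  choose M hΦ hI hΔ using fun A => h (cutOrder A) (isStableOrder_cutOrder A)
  have hcont : ∀ A n, ∃ k, ∀ B, AgreeBelow k A B → (n ∈ M A ↔ n ∈ M B) := by
    intro A n
    obtain ⟨k, hk⟩ := (hΦ A).exists_use n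
    exact ⟨k, fun B hB => hk _ _ hB.cutOrder (hΦ B)⟩
  obtain ⟨A, hA⟩ := exists_deciding M hcont
  have hlin : ∀ B, CodesLinearOrder (M B) := fun B => (hI B).1.1
  have hasc := (hlin A).isAscendingSequence_smallRecords
  have hinf := (hlin A).infinite_smallRecords (hI A).2.1
  obtain ⟨Y, hY, hYsol⟩ := hΔ A (smallRecords (M A)) ⟨hinf, Or.inl hasc⟩
  obtain ⟨w, hw⟩ := hYsol.1.nonempty
  obtain ⟨u, hu⟩ := hY.exists_use w
  -- `s` is the last element of the finite part of the sequence that is kept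
  obtain ⟨s, hs, hus⟩ := hinf.exists_gt u
  -- a finite part of `A` guarantees that `s` is small
  obtain ⟨m, hm⟩ : BddAbove {y | codedLT (M A) y s} := hs.1.bddAbove
  obtain ⟨k, hk⟩ := (hA s m).resolve_left fun ⟨n, hn, hlt⟩ => absurd (hm hlt) (not_le.2 hn)
  -- a finite part of `A` determines the order of `M` on the numbers up to `s`
  choose c hc using hcont A
  let l := (Finset.range (Nat.pair (s + 1) (s + 1))).sup c
  obtain ⟨B, hAB, hB⟩ := exists_no_chain_through A (max (max k l) (max u (w + 1))) w
    (lt_max_of_lt_right (lt_max_of_lt_right w.lt_succ_self))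
  have hsB : IsSmall (M B) s := (Set.finite_Iic m).subset fun n hn => by
    by_contra hmn
    exact hk B (hAB.mono (by simp)) n (not_le.1 hmn) hn
  have hascB : IsAscendingSequence (M B) (smallRecords (M A) ∩ Set.Iic s) := by
    intro x hx y hy hxy
    have hlt : Nat.pair x y < Nat.pair (s + 1) (s + 1) :=
      (Nat.pair_lt_pair_left y (Nat.lt_succ_of_le hx.2)).trans
        (Nat.pair_lt_pair_right _ (Nat.lt_succ_of_le hy.2))
    have hcl : c (Nat.pair x y) ≤ l := Finset.le_sup (f := c) (Finset.mem_range.2 hlt)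
    exact (hc _ B (hAB.mono (by simp [hcl]))).1 (hasc x hx.1 y hy.1 hxy)
  obtain ⟨T, hT, hTasc, hST⟩ := (hlin B).exists_extend_ascending (hI B).2.1 hs hsB hascB
  obtain ⟨Z, hZ, hZsol⟩ := hΔ B T ⟨hT, Or.inl hTasc⟩
  have hjoin : AgreeBelow u (joinSet (cutOrder A) (smallRecords (M A)))
      (joinSet (cutOrder B) T) :=
    (hAB.mono (by simp)).cutOrder.joinSet (hST.mono (by omega))
  exact hB Z hZsol ((hu _ _ hjoin hZ).1 hw)

theorem mainTheorem3 :
    ¬ GeneralSADC.WeihrauchLE SADS ∧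
      SADS.WeihrauchLT GeneralSADS ∧
      SADC.WeihrauchLT GeneralSADC := by
  refine ⟨generalSADC_not_weihrauchLE_SADS, ⟨?_, fun h => ?_⟩, ⟨?_, fun h => ?_⟩⟩
  · exact Problem.weihrauchLE_of_imp (fun X hX => hX.1) fun X Y hY => hY
  · exact generalSADC_not_weihrauchLE_SADS <| h.mono (fun X hX => hX)
      (fun X Y hX hY => CodesLinearOrder.chain_of_sequence hX.1 hY) (fun X hX => hX)
      fun X Y _ hY => hY
  · exact Problem.weihrauchLE_of_imp (fun X hX => hX.1) fun X Y hY => hY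
  · exact generalSADC_not_weihrauchLE_SADS <| h.mono (fun X hX => hX)
      (fun X Y _ hY => hY) (fun X hX => hX)
      fun X Y hX hY => CodesLinearOrder.chain_of_sequence hX.1.1 hY
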